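/- A Datalog program $\Pi$ is a finite set of rules $R_0(\mathbf x_0) \text{ :- } R_1(\mathbf x_1)\wedge\dots\wedge R_n(\mathbf x_n)$, each $\mathbf x_i$ being a tuple of variables and constants. Predicates that occur in the head of a rule are intensional (IDB), the other predicates of $\Pi$ are extensional (EDB), and one IDB $T$ is designated as the target. An input $I$ is a finite set of facts over the EDBs of $\Pi$, and $|I|$ is the number of its facts. A grounding of a rule instantiates its variables with constants that occur in $I$. A proof tree of an IDB fact $\alpha$ is a finite rooted tree with vertices labeled by facts, whose root is labeled $\alpha$, whose leaves are labeled by facts of $I$, and such that every internal vertex $v$ with children $u_1,\dots,u_n$ corresponds to a grounding $\lambda(v)\text{ :- }\lambda(u_1),\dots,\lambda(u_n)$ of a rule. (A rule with an empty body, if present, gives an internal vertex without children.) The tree is tight if no two different internal vertices on a common leaf-to-root path have the same label. There are finitely many tight proof trees of $\alpha$. With a variable $x_\beta$ for each $\beta\in I$, the provenance polynomial of $\alpha$ is the formal polynomial $$p^I_\Pi(\alpha)=\bigoplus_{\tau \text{ tight proof tree of } \alpha}\ \bigotimes_{t \text{ leaf of } \tau} x_{\lambda(t)} .$$ The program $\Pi$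 has the polynomial fringe property if there is a polynomial $q_0$ such that for every input $I$, every tight proof tree of a fact of $T$ has at most $q_0(|I|)$ vertices. It is linear if the body of each rule contains at most one IDB atom. A commutative semiring $\mathbb S$ is absorptive if $\mathbf 1\oplus x=\mathbf 1$ for all $x$. A circuit is a directed acyclic graph whose input gates are variables $x_\beta$ ($\beta\in I$) or constants $\mathbf 0,\mathbf 1$, and whose other gates are $\oplus$- or $\otimes$-gates of fan-in two; its size is the number of its gates and its depth is the length of a longest path. It computes $p$ over $\mathbb S$ if the polynomial at its output gate and $p$ define the same function over $\mathbb S$. **Theorem.** Let $\Pi$ be a Datalog program with target $T$. 1. If $\Pi$ has the polynomial fringe property, then there are a polynomial $q$ and a constant $c$, depending only on $\Pi$, such that for every absorptive semiring $\mathbb S$, every input $I$ and every fact $\alpha$ of $T$, there is a circuit that computes $p^I_\Pi(\alpha)$ over $\mathbb S$, has size at most $q(|I|)$ and has depth at most $c\,\log^2(|I|+2)$. That is, it has polynomial size and depth $O(\log^2|I|)$. 2. The same conclusion holds if $\Pi$ is linear. -/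

import Mathlib

namespace Datalog

/-! ### Syntax -/

/-- A term over the constants `C`: a variable (named by a natural number) or a constant. -/
inductive Term (C : Type*) where
  | var (x : ℕ)
  | const (c : C)

/-- An atom with arguments in `A`; the relation name `r` has arity `ar r`. -/
@[ext] structure Atom {R : Type*} (ar : R → ℕ) (A : Type*) where
  rel : R
  args : Fin (ar rel) → A

/-- A rule `head :- body`, the body being a conjunction of atoms. -/
@[ext] structure Rule {R : Type*} (ar : R → ℕ) (A : Type*) where
  head : Atom ar A
  body : List (Atom ar A)

/-- A fact is an atom whose arguments are constants. -/
abbrev Fact {R : Type*} (ar : R → ℕ) (C : Type*) := Atom ar C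

section
variable {R C : Type*} {ar : R → ℕ}

def Atom.map {A B : Type*} (f : A → B) (a : Atom ar A) : Atom ar B :=
  ⟨a.rel, fun i => f (a.args i)⟩

def Rule.map {A B : Type*} (f : A → B) (r : Rule ar A) : Rule ar B :=
  ⟨r.head.map f, r.body.map (Atom.map f)⟩

/-- The value of a term under an instantiation of the variables. -/
def Term.inst (ν : ℕ → C) : Term C → C
  | .var x => ν x
  | .const c => c

/-- The variables that occur in an atom. -/
def Atom.vars (a : Atom ar (Term C)) : Set ℕ := {x | ∃ i, a.args i = .var x}

/-- The variables that occur in a rule (in its head or in its body). -/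
def Rule.vars (r : Rule ar (Term C)) : Set ℕ := {x | ∃ a ∈ r.head :: r.body, x ∈ a.vars}

/-- The finite set of all constants that occur in a finite set of facts. -/
def activeDomain (I : Finset (Fact ar C)) : Set C := {c | ∃ a ∈ I, ∃ i, a.args i = c}

end

/-- A Datalog program: a finite set of rules with a designated target predicate, which is
intensional, that is, which occurs in the head of some rule. -/
structure Program {R : Type*} (ar : R → ℕ) (C : Type*) where
  rules : Finset (Rule ar (Term C))
  target : R
  target_idb : ∃ r ∈ rules, r.head.rel = target

namespace Program
variable {R C : Type*} {ar : R → ℕ} (P : Program ar C)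

/-- Intensional predicates: those in the head of some rule. -/
def IsIDB (p : R) : Prop := ∃ r ∈ P.rules, r.head.rel = p

/-- Extensional predicates: those that occur in the program, but in no head. -/
def IsEDB (p : R) : Prop := (∃ r ∈ P.rules, ∃ a ∈ r.body, a.rel = p) ∧ ¬ P.IsIDB p

/-- An input database of the program: finitely many facts of extensional predicates.
Its size is the number of its facts. -/
def IsInput (I : Finset (Fact ar C)) : Prop := ∀ a ∈ I, P.IsEDB a.rel

/-- A program is linear if the body of each rule has at most one intensional atom. -/
def IsLinear : Prop :=
  ∀ r ∈ P.rules, ∀ i j : Fin r.body.length,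
    P.IsIDB (r.body.get i).rel → P.IsIDB (r.body.get j).rel → i = j

/-- The grounded program: all rules obtained from a rule of the program by instantiating each of
its variables with a constant from the active domain. -/
def grounding (I : Finset (Fact ar C)) : Set (Rule ar C) :=
  {g | ∃ r ∈ P.rules, ∃ ν : ℕ → C,
    (∀ x ∈ r.vars, ν x ∈ activeDomain I) ∧ g = r.map (Term.inst ν)}

end Program

/-! ### Proof trees -/

/-- Finite rooted trees whose vertices are labeled with facts; the label of a leaf belongs
to `I`. -/
inductive FactTree {R C : Type*} {ar : R → ℕ} (I : Finset (Fact ar C)) where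
  | leaf (a : {a // a ∈ I})
  | node (a : Fact ar C) (n : ℕ) (child : Fin n → FactTree I)

namespace FactTree
variable {R C : Type*} {ar : R → ℕ} {I : Finset (Fact ar C)}

/-- The label of the root. -/
def label : FactTree I → Fact ar C
  | leaf a => a.1
  | node a _ _ => a

/-- The number of vertices. -/
def size : FactTree I → ℕ
  | leaf _ => 1
  | node _ _ child => 1 + ∑ i, (child i).size

/-- The set of the labels of the internal vertices. -/
def internalLabels : FactTree I → Set (Fact ar C)
  | leaf _ => ∅
  | node a _ child => insert a (⋃ i, (child i).internalLabels)

/-- Every internal vertex `v` with children `u₁, …, uₙ` comes from a grounding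
`label v :- label u₁, …, label uₙ` of a rule. -/
def Derives (P : Program ar C) : FactTree I → Prop
  | leaf _ => True
  | node a _ child =>
      (⟨a, List.ofFn fun i => (child i).label⟩ : Rule ar C) ∈ P.grounding I ∧
        ∀ i, (child i).Derives P

/-- `t` is a proof tree of the fact `α`. -/
def IsProofTree (P : Program ar C) (α : Fact ar C) (t : FactTree I) : Prop :=
  t.label = α ∧ t.Derives P

/-- A tree is tight if no two different internal vertices on a common leaf-to-root path have the
same label. -/
def IsTight : FactTree I → Prop
  | leaf _ => True
  | node a _ child =>
      (∀ i, a ∉ (child i).internalLabels) ∧ ∀ i, (child i).IsTight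

/-- The product of the variables of the leaves, taken with multiplicity. -/
noncomputable def monomial : FactTree I → MvPolynomial {a // a ∈ I} ℕ
  | leaf a => MvPolynomial.X a
  | node _ _ child => ∏ i, (child i).monomial

end FactTree

/-! ### There are only finitely many tight proof trees -/

section
variable {R C : Type*} {ar : R → ℕ}

theorem activeDomain_finite (I : Finset (Fact ar C)) : (activeDomain I).Finite := by
  have : activeDomain I = ⋃ a ∈ (I : Set (Fact ar C)), Set.range a.args := by
    ext c; simp [activeDomain]
  rw [this]
  exact I.finite_toSet.biUnion fun a _ => Set.finite_range _

theorem Atom.vars_finite (a : Atom ar (Term C)) : a.vars.Finite := by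
  refine ((Set.finite_range a.args).preimage (f := Term.var) ?_).subset ?_
  · intro x _ y _ h
    exact Term.var.inj h
  · rintro x ⟨i, hi⟩
    exact ⟨i, hi⟩

theorem Rule.vars_finite (r : Rule ar (Term C)) : r.vars.Finite := by
  have : r.vars = ⋃ a ∈ {a | a ∈ r.head :: r.body}, a.vars := by
    ext x; simp [Rule.vars]
  rw [this]
  exact (List.finite_toSet _).biUnion fun a _ => a.vars_finite

theorem Rule.map_inst_congr (r : Rule ar (Term C)) {ν μ : ℕ → C}
    (h : ∀ x ∈ r.vars, ν x = μ x) : r.map (Term.inst ν) = r.map (Term.inst μ) := by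
  have key : ∀ a ∈ r.head :: r.body, a.map (Term.inst ν) = a.map (Term.inst μ) := by
    intro a ha
    have : ∀ i, (a.args i).inst ν = (a.args i).inst μ := by
      intro i
      cases hi : a.args i with
      | var x => exact h x ⟨a, ha, i, hi⟩
      | const c => rfl
    simp only [Atom.map, this]
  simp only [Rule.map, Rule.mk.injEq]
  exact ⟨key _ (by simp), List.map_congr_left fun a ha => key a (by simp [ha])⟩

theorem Program.grounding_finite (P : Program ar C) (I : Finset (Fact ar C)) :
    (P.grounding I).Finite := by
  classical
  have : P.grounding I = ⋃ r ∈ (P.rules : Set (Rule ar (Term C))),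
      {g | ∃ ν : ℕ → C, (∀ x ∈ r.vars, ν x ∈ activeDomain I) ∧ g = r.map (Term.inst ν)} := by
    ext g; simp [Program.grounding]
  rw [this]
  refine P.rules.finite_toSet.biUnion fun r _ => ?_
  rcases isEmpty_or_nonempty C with hC | ⟨⟨c⟩⟩
  · refine Set.Finite.subset Set.finite_empty ?_
    rintro g ⟨ν, -⟩
    exact hC.elim (ν 0)
  have := r.vars_finite.to_subtype
  have := (activeDomain_finite I).to_subtype
  refine (Set.finite_range fun f : r.vars → activeDomain I =>
    r.map (Term.inst fun x => if hx : x ∈ r.vars then (f ⟨x, hx⟩).1 else c)).subset ?_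
  rintro g ⟨ν, hν, rfl⟩
  refine ⟨fun x => ⟨ν x.1, hν x.1 x.2⟩, r.map_inst_congr fun x hx => ?_⟩
  simp [hx]

theorem FactTree.finite_aux (P : Program ar C) (I : Finset (Fact ar C)) (U : Finset (Fact ar C)) :
    {t : FactTree I | t.Derives P ∧ t.IsTight ∧ t.internalLabels ⊆ U}.Finite := by
  classical
  induction U using Finset.strongInduction with
  | H U ih =>
    refine ((Set.finite_range (FactTree.leaf (I := I))).union
      ((P.grounding_finite I).biUnion (t := fun g => {t : FactTree I | g.head ∈ U ∧
        ∃ c : Fin g.body.length → FactTree I, t = .node g.head g.body.length c ∧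
          ∀ i, c i ∈ {t : FactTree I | t.Derives P ∧ t.IsTight ∧
            t.internalLabels ⊆ (U.erase g.head : Finset _)}}) ?_)).subset ?_
    · intro g _
      by_cases hg : g.head ∈ U
      · refine ((Set.Finite.pi' fun _ : Fin g.body.length =>
          ih (U.erase g.head) (Finset.erase_ssubset hg)).image
            (FactTree.node g.head g.body.length)).subset ?_
        rintro t ⟨-, c, rfl, hc⟩
        exact ⟨c, hc, rfl⟩
      · refine Set.finite_empty.subset ?_
        rintro t ⟨h, -⟩
        exact hg h
    · rintro (a | ⟨a, n, c⟩) ⟨h1, h2, h3⟩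
      · exact Or.inl ⟨a, rfl⟩
      · right
        simp only [FactTree.Derives, FactTree.IsTight, FactTree.internalLabels] at h1 h2 h3
        refine Set.mem_biUnion h1.1 ?_
        have hlen : (List.ofFn fun i => (c i).label).length = n := by simp
        refine ⟨h3 (Set.mem_insert _ _), fun i => c (i.cast hlen), ?_, ?_⟩
        · simp only [FactTree.node.injEq, true_and]
          refine ⟨hlen.symm, ?_⟩
          generalize (List.ofFn fun i => (c i).label).length = m at hlen
          subst hlen
          rfl
        · intro i
          refine ⟨h1.2 _, h2.2 _, fun x hx => ?_⟩
          have hxU := h3 (Set.mem_insert_of_mem _ (Set.mem_iUnion.2 ⟨_, hx⟩))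
          refine Finset.mem_coe.2 (Finset.mem_erase.2 ⟨?_, hxU⟩)
          rintro rfl
          exact h2.1 _ hx

theorem FactTree.internalLabels_subset (P : Program ar C) {I : Finset (Fact ar C)} (t : FactTree I)
    (h : t.Derives P) : t.internalLabels ⊆ Rule.head '' P.grounding I := by
  induction t with
  | leaf a => simp [FactTree.internalLabels]
  | node a n c ih =>
    simp only [FactTree.Derives, FactTree.internalLabels] at h ⊢
    refine Set.insert_subset ⟨_, h.1, rfl⟩ (Set.iUnion_subset fun i => ih i (h.2 i))

theorem Program.tightProofTrees_finite (P : Program ar C) (I : Finset (Fact ar C))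
    (α : Fact ar C) : {t : FactTree I | t.IsProofTree P α ∧ t.IsTight}.Finite := by
  refine (FactTree.finite_aux P I ((P.grounding_finite I).image Rule.head).toFinset).subset ?_
  rintro t ⟨⟨-, h1⟩, h2⟩
  refine ⟨h1, h2, ?_⟩
  rw [Set.Finite.coe_toFinset]
  exact t.internalLabels_subset P h1

end

/-! ### The polynomial fringe property and provenance polynomials -/

namespace Program
variable {R C : Type*} {ar : R → ℕ} (P : Program ar C)

/-- The polynomial fringe property: the size of the tight proof trees of the facts of the target
is bounded by a polynomial in the size of the input. -/
def PolynomialFringe : Prop :=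
  ∃ q : Polynomial ℕ, ∀ I : Finset (Fact ar C), P.IsInput I →
    ∀ α : Fact ar C, α.rel = P.target →
      ∀ t : FactTree I, t.IsProofTree P α → t.IsTight → t.size ≤ q.eval I.card

/-- The provenance polynomial of the fact `α` on the input `I`: the formal sum, over all tight
proof trees of `α`, of the products of the variables of their leaves. There is one variable for
each fact of `I`. -/
noncomputable def provenance (I : Finset (Fact ar C)) (α : Fact ar C) :
    MvPolynomial {a // a ∈ I} ℕ :=
  ∑ t ∈ (P.tightProofTrees_finite I α).toFinset, t.monomial

end Program

/-- A commutative semiring is absorptive if `1 + x = 1` for all `x`. -/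
def IsAbsorptive (S : Type*) [CommSemiring S] : Prop := ∀ x : S, 1 + x = 1

/-- Two formal polynomials are equivalent over `S` if they define the same function over `S`. -/
def EquivOver (S : Type*) [CommSemiring S] {X : Type*} (p q : MvPolynomial X ℕ) : Prop :=
  ∀ v : X → S, MvPolynomial.aeval v p = MvPolynomial.aeval v q

/-! ### Circuits -/

/-- The gate at position `i` of a circuit: an input gate (a variable or a constant `0`, `1`), or
an addition or multiplication gate of fan-in two that reads gates at earlier positions. -/
inductive Gate (X : Type*) (i : ℕ) where
  | var (x : X)
  | zero
  | one
  | add (a b : Fin i)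
  | mul (a b : Fin i)

/-- A circuit with input variables `X`: a directed acyclic graph of gates, listed in a topological
order. The last gate, which necessarily has fan-out zero, is the output gate. -/
structure Circuit (X : Type*) where
  last : ℕ
  gate : (i : Fin (last + 1)) → Gate X i

namespace Circuit
variable {X : Type*} (F : Circuit X)

/-- The number of gates, input gates included. -/
def size : ℕ := F.last + 1

/-- The polynomial at a gate, obtained by evaluating the circuit bottom-up. -/
noncomputable def gatePoly (i : Fin (F.last + 1)) : MvPolynomial X ℕ :=
  match F.gate i with
  | .var x => MvPolynomial.X x
  | .zero => 0
  | .one => 1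
  | .add a b => gatePoly (a.castLE i.2.le) + gatePoly (b.castLE i.2.le)
  | .mul a b => gatePoly (a.castLE i.2.le) * gatePoly (b.castLE i.2.le)
termination_by i.1
decreasing_by all_goals simp

/-- The length of a longest path from an input gate to the given gate. -/
def gateDepth (i : Fin (F.last + 1)) : ℕ :=
  match F.gate i with
  | .var _ => 0
  | .zero => 0
  | .one => 0
  | .add a b => max (gateDepth (a.castLE i.2.le)) (gateDepth (b.castLE i.2.le)) + 1
  | .mul a b => max (gateDepth (a.castLE i.2.le)) (gateDepth (b.castLE i.2.le)) + 1
termination_by i.1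
decreasing_by all_goals simp

/-- The length of a longest path in the circuit. -/
def depth : ℕ := Finset.univ.sup F.gateDepth

/-- The polynomial that the circuit produces at its output gate. -/
noncomputable def poly : MvPolynomial X ℕ := F.gatePoly (Fin.last F.last)

/-- The circuit computes `p` over `S` if the polynomial it produces is equivalent to `p`
over `S`. -/
def Computes (S : Type*) [CommSemiring S] (p : MvPolynomial X ℕ) : Prop :=
  EquivOver S F.poly p

end Circuit

end Datalog

/-! In an absorptive semiring addition is idempotent, and `1` is the greatest element for the order
`a ≤ b ↔ a + b = b`. Hence a product lies below each of its factors, and a proof tree that is not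
tight lies below a tight one obtained by cutting out repetitions (`exists_tight`). Non-tight trees
may therefore be added freely, and it is enough to bound the circuit's value from both sides.

The grounded program is made binary. Items are lists of facts read as conjunctions: a nonempty list
splits into its first fact and the rest, and the head of a grounding comes from its body. Only
suffixes of grounded bodies and singletons are needed, so there are polynomially many items. A tight
proof tree becomes a binary derivation of at most four times its size.

Such derivations can have linear depth, so they are balanced by also computing contexts, that is,
derivations with one hole. `contextValue` is a matrix indexed by items; one round squares it and
adds the one-step contexts whose side tree is already known. A derivation is a context whose hole is
the empty conjunction, of value `1`.

Cutting a derivation or context of size at most `2 ^ (k + 1)` at a balanced vertex leaves parts that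
were found earlier, so four rounds double the size covered (`le_contextValue`). Conversely no round
exceeds the provenance (`contextValue_mul_le`). With polynomially large trees `O(log |I|)` rounds
suffice. Each round consists of one layer of products and balanced sums of polynomially many terms,
of depth `O(log |I|)`, which gives polynomial size and depth `O(log² |I|)`.

For a linear program, the internal vertices of a proof tree form a single path. Tightness makes
their labels distinct, and labels are heads of groundings, so the polynomial fringe property follows
(`size_le_of_isLinear`). -/

namespace Datalog

/-! ### Building circuits layer by layer -/

namespace Circuit
variable {X : Type*}

theorem gatePoly_var {F : Circuit X} {i : Fin (F.last + 1)} {x : X} (h : F.gate i = .var x) :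
    F.gatePoly i = MvPolynomial.X x := by
  rw [gatePoly, h]

theorem gatePoly_zero {F : Circuit X} {i : Fin (F.last + 1)} (h : F.gate i = .zero) :
    F.gatePoly i = 0 := by
  rw [gatePoly, h]

theorem gatePoly_one {F : Circuit X} {i : Fin (F.last + 1)} (h : F.gate i = .one) :
    F.gatePoly i = 1 := by
  rw [gatePoly, h]

theorem gatePoly_add {F : Circuit X} {i : Fin (F.last + 1)} {a b : Fin i}
    (h : F.gate i = .add a b) :
    F.gatePoly i = F.gatePoly (a.castLE i.2.le) + F.gatePoly (b.castLE i.2.le) := by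
  rw [gatePoly, h]

theorem gatePoly_mul {F : Circuit X} {i : Fin (F.last + 1)} {a b : Fin i}
    (h : F.gate i = .mul a b) :
    F.gatePoly i = F.gatePoly (a.castLE i.2.le) * F.gatePoly (b.castLE i.2.le) := by
  rw [gatePoly, h]

theorem gateDepth_var {F : Circuit X} {i : Fin (F.last + 1)} {x : X} (h : F.gate i = .var x) :
    F.gateDepth i = 0 := by
  rw [gateDepth, h]

theorem gateDepth_zero {F : Circuit X} {i : Fin (F.last + 1)} (h : F.gate i = .zero) :
    F.gateDepth i = 0 := by
  rw [gateDepth, h]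

theorem gateDepth_one {F : Circuit X} {i : Fin (F.last + 1)} (h : F.gate i = .one) :
    F.gateDepth i = 0 := by
  rw [gateDepth, h]

theorem gateDepth_add {F : Circuit X} {i : Fin (F.last + 1)} {a b : Fin i}
    (h : F.gate i = .add a b) : F.gateDepth i =
      max (F.gateDepth (a.castLE i.2.le)) (F.gateDepth (b.castLE i.2.le)) + 1 := by
  rw [gateDepth, h]

theorem gateDepth_mul {F : Circuit X} {i : Fin (F.last + 1)} {a b : Fin i}
    (h : F.gate i = .mul a b) : F.gateDepth i =
      max (F.gateDepth (a.castLE i.2.le)) (F.gateDepth (b.castLE i.2.le)) + 1 := by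
  rw [gateDepth, h]

/-- The circuit with one more gate, which becomes the output gate. -/
def snoc (F : Circuit X) (g : Gate X (F.last + 1)) : Circuit X where
  last := F.last + 1
  gate := Fin.snoc (α := fun i : Fin (F.last + 2) => Gate X i) F.gate g

theorem snoc_gate_castSucc (F : Circuit X) (g : Gate X (F.last + 1)) (i : Fin (F.last + 1)) :
    (F.snoc g).gate i.castSucc = F.gate i :=
  Fin.snoc_castSucc (α := fun i : Fin (F.last + 2) => Gate X i) g F.gate i

theorem snoc_gate_last (F : Circuit X) (g : Gate X (F.last + 1)) :
    (F.snoc g).gate (Fin.last (F.last + 1)) = g :=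
  Fin.snoc_last (α := fun i : Fin (F.last + 2) => Gate X i) g F.gate

/-- Gates read only earlier positions, so a gate appended at the end does not affect them. -/
theorem snoc_castSucc (F : Circuit X) (g : Gate X (F.last + 1)) (i : Fin (F.last + 1)) :
    (F.snoc g).gatePoly i.castSucc = F.gatePoly i ∧
      (F.snoc g).gateDepth i.castSucc = F.gateDepth i := by
  induction i using WellFoundedLT.induction with
  | ind i ih =>
    have hg := F.snoc_gate_castSucc g i
    cases hi : F.gate i with
    | var x =>
      rw [hi] at hg
      rw [gatePoly_var hg, gatePoly_var hi, gateDepth_var hg, gateDepth_var hi]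
      exact ⟨rfl, rfl⟩
    | zero =>
      rw [hi] at hg
      rw [gatePoly_zero hg, gatePoly_zero hi, gateDepth_zero hg, gateDepth_zero hi]
      exact ⟨rfl, rfl⟩
    | one =>
      rw [hi] at hg
      rw [gatePoly_one hg, gatePoly_one hi, gateDepth_one hg, gateDepth_one hi]
      exact ⟨rfl, rfl⟩
    | add a b =>
      rw [hi] at hg
      have ha := ih (a.castLE i.2.le) a.2
      have hb := ih (b.castLE i.2.le) b.2
      rw [gatePoly_add hg, gatePoly_add hi, gateDepth_add hg, gateDepth_add hi,
        ← ha.1, ← ha.2, ← hb.1, ← hb.2]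
      exact ⟨rfl, rfl⟩
    | mul a b =>
      rw [hi] at hg
      have ha := ih (a.castLE i.2.le) a.2
      have hb := ih (b.castLE i.2.le) b.2
      rw [gatePoly_mul hg, gatePoly_mul hi, gateDepth_mul hg, gateDepth_mul hi,
        ← ha.1, ← ha.2, ← hb.1, ← hb.2]
      exact ⟨rfl, rfl⟩

theorem gateDepth_le_depth (F : Circuit X) (i : Fin (F.last + 1)) : F.gateDepth i ≤ F.depth :=
  Finset.le_sup (Finset.mem_univ i)

theorem snoc_depth_le {F : Circuit X} {g : Gate X (F.last + 1)} {d : ℕ} (hF : F.depth ≤ d)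
    (hg : (F.snoc g).gateDepth (Fin.last (F.last + 1)) ≤ d) : (F.snoc g).depth ≤ d := by
  refine Finset.sup_le fun i _ => ?_
  induction i using Fin.lastCases with
  | last => exact hg
  | cast i => exact (F.snoc_castSucc g i).2.trans_le ((F.gateDepth_le_depth i).trans hF)

/-- Some gate of depth at most `d` carries the polynomial `p`. -/
def Has (F : Circuit X) (d : ℕ) (p : MvPolynomial X ℕ) : Prop :=
  ∃ i, F.gatePoly i = p ∧ F.gateDepth i ≤ d

theorem Has.snoc {F : Circuit X} {d : ℕ} {p : MvPolynomial X ℕ} (h : F.Has d p)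
    (g : Gate X (F.last + 1)) : (F.snoc g).Has d p := by
  obtain ⟨i, h1, h2⟩ := h
  exact ⟨i.castSucc, (F.snoc_castSucc g i).1.trans h1, (F.snoc_castSucc g i).2.trans_le h2⟩

/-- One more gate for the sum or the product of two polynomials that are present. -/
theorem exists_snoc {F : Circuit X} {d : ℕ} {p q r : MvPolynomial X ℕ} (hp : F.Has d p)
    (hq : F.Has d q) (hr : r = p + q ∨ r = p * q) (hF : F.depth ≤ d + 1) :
    ∃ g, (F.snoc g).poly = r ∧ (F.snoc g).depth ≤ d + 1 := by
  obtain ⟨i, hi, hid⟩ := hp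
  obtain ⟨j, hj, hjd⟩ := hq
  have hi' := F.snoc_castSucc
  rcases hr with rfl | rfl
  · have hg := F.snoc_gate_last (.add i j)
    refine ⟨.add i j, ?_, snoc_depth_le hF ?_⟩
    · refine (gatePoly_add hg).trans ?_
      rw [← hi, ← hj, ← (hi' (.add i j) i).1, ← (hi' (.add i j) j).1]
      rfl
    · rw [gateDepth_add hg]
      refine Nat.succ_le_succ (max_le ?_ ?_)
      · exact (hi' (.add i j) i).2.trans_le hid
      · exact (hi' (.add i j) j).2.trans_le hjd
  · have hg := F.snoc_gate_last (.mul i j)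
    refine ⟨.mul i j, ?_, snoc_depth_le hF ?_⟩
    · refine (gatePoly_mul hg).trans ?_
      rw [← hi, ← hj, ← (hi' (.mul i j) i).1, ← (hi' (.mul i j) j).1]
      rfl
    · rw [gateDepth_mul hg]
      refine Nat.succ_le_succ (max_le ?_ ?_)
      · exact (hi' (.mul i j) i).2.trans_le hid
      · exact (hi' (.mul i j) j).2.trans_le hjd

theorem has_snoc_poly {F : Circuit X} {d : ℕ} {p : MvPolynomial X ℕ} (h : F.poly = p)
    (hd : F.depth ≤ d) : F.Has d p :=
  ⟨Fin.last _, h, (F.gateDepth_le_depth _).trans hd⟩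

/-- A circuit with at most `s` gates and of depth at most `d` computes all members of `A`. -/
def Realizable (s d : ℕ) (A : Set (MvPolynomial X ℕ)) : Prop :=
  ∃ F : Circuit X, F.size ≤ s ∧ F.depth ≤ d ∧ ∀ p ∈ A, F.Has d p

theorem Realizable.mono {s s' d d' : ℕ} {A A' : Set (MvPolynomial X ℕ)} (h : Realizable s d A)
    (hs : s ≤ s') (hd : d ≤ d') (hA : A' ⊆ A) : Realizable s' d' A' := by
  obtain ⟨F, h1, h2, h3⟩ := h
  refine ⟨F, h1.trans hs, h2.trans hd, fun p hp => ?_⟩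
  obtain ⟨i, hi, hi'⟩ := h3 p (hA hp)
  exact ⟨i, hi, hi'.trans hd⟩

theorem realizable_input (B : Finset (MvPolynomial X ℕ))
    (hB : ∀ b ∈ B, b = 0 ∨ b = 1 ∨ ∃ x, b = MvPolynomial.X x) :
    Realizable (1 + B.card) 0 (B : Set (MvPolynomial X ℕ)) := by
  classical
  induction B using Finset.induction_on with
  | empty =>
    refine ⟨⟨0, fun _ => .zero⟩, by simp [size], Finset.sup_le fun i _ => ?_, by simp⟩
    rw [gateDepth_zero rfl]
  | insert b B hb ih =>
    obtain ⟨F, h1, h2, h3⟩ := ih fun p hp => hB p (Finset.mem_insert_of_mem hp)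
    have key : ∃ g, (F.snoc g).poly = b ∧ (F.snoc g).depth ≤ 0 := by
      rcases hB b (Finset.mem_insert_self _ _) with rfl | rfl | ⟨x, rfl⟩
      · have hg := F.snoc_gate_last .zero
        exact ⟨.zero, gatePoly_zero hg, snoc_depth_le h2 (gateDepth_zero hg).le⟩
      · have hg := F.snoc_gate_last .one
        exact ⟨.one, gatePoly_one hg, snoc_depth_le h2 (gateDepth_one hg).le⟩
      · have hg := F.snoc_gate_last (.var x)
        exact ⟨.var x, gatePoly_var hg, snoc_depth_le h2 (gateDepth_var hg).le⟩
    obtain ⟨g, hg, hgd⟩ := key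
    refine ⟨F.snoc g, ?_, hgd, fun p hp => ?_⟩
    · rw [Finset.card_insert_of_notMem hb]
      simp only [size, Circuit.snoc] at h1 ⊢
      omega
    · rcases Finset.mem_insert.1 (Finset.mem_coe.1 hp) with rfl | hp
      · exact has_snoc_poly hg hgd
      · exact (h3 p hp).snoc g

theorem Realizable.layer {s d : ℕ} {A : Set (MvPolynomial X ℕ)} (h : Realizable s d A)
    (B : Finset (MvPolynomial X ℕ))
    (hB : ∀ b ∈ B, ∃ x ∈ A, ∃ y ∈ A, b = x + y ∨ b = x * y) :
    Realizable (s + B.card) (d + 1) (A ∪ B) := by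
  classical
  obtain ⟨F, h1, h2, h3⟩ := h
  -- Keeping `A` at depth `d` separately from `B` lets every new gate read `A` alone, so the gates
  -- of one layer do not stack.
  suffices H : ∃ F : Circuit X, F.size ≤ s + B.card ∧ F.depth ≤ d + 1 ∧
      (∀ p ∈ A, F.Has d p) ∧ ∀ p ∈ B, F.Has (d + 1) p by
    obtain ⟨F, h1, h2, h3, h4⟩ := H
    refine ⟨F, h1, h2, ?_⟩
    rintro p (hp | hp)
    · obtain ⟨i, hi, hi'⟩ := h3 p hp
      exact ⟨i, hi, hi'.trans (Nat.le_succ d)⟩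
    · exact h4 p hp
  induction B using Finset.induction_on with
  | empty => exact ⟨F, h1, h2.trans (Nat.le_succ d), h3, by simp⟩
  | insert b B hb ih =>
    obtain ⟨F, h1, h2, h3, h4⟩ := ih fun p hp => hB p (Finset.mem_insert_of_mem hp)
    obtain ⟨x, hx, y, hy, hxy⟩ := hB b (Finset.mem_insert_self _ _)
    obtain ⟨g, hg, hgd⟩ := exists_snoc (h3 x hx) (h3 y hy) hxy h2
    refine ⟨F.snoc g, ?_, hgd, fun p hp => (h3 p hp).snoc g, fun p hp => ?_⟩
    · rw [Finset.card_insert_of_notMem hb]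
      simp only [size, Circuit.snoc] at h1 ⊢
      omega
    · rcases Finset.mem_insert.1 hp with rfl | hp
      · exact has_snoc_poly hg hgd
      · exact (h4 p hp).snoc g

/-- Sums of at most `2 ^ m` terms are computed by balanced trees of depth `m`. -/
theorem Realizable.sums {s d : ℕ} {A : Set (MvPolynomial X ℕ)} (h : Realizable s d A)
    (h0 : 0 ∈ A) (m : ℕ) (L : Finset (List (MvPolynomial X ℕ)))
    (hL : ∀ l ∈ L, l.length ≤ 2 ^ m ∧ ∀ p ∈ l, p ∈ A) :
    Realizable (s + L.card * (2 ^ m - 1)) (d + m) (A ∪ List.sum '' (L : Set (List _))) := by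
  classical
  induction m generalizing L with
  | zero =>
    refine h.mono (by simp) le_rfl (Set.union_subset subset_rfl ?_)
    rintro _ ⟨l, hl, rfl⟩
    obtain ⟨h1, h2⟩ := hL l hl
    match l with
    | [] => simpa using h0
    | [p] => simpa using h2
    | _ :: _ :: _ => simp at h1
  | succ m ih =>
    have hcard : (L.image (List.take (2 ^ m)) ∪ L.image (List.drop (2 ^ m))).card ≤ 2 * L.card :=
      (Finset.card_union_le _ _).trans (by
        have h1 := Finset.card_image_le (s := L) (f := List.take (2 ^ m))
        have h2 := Finset.card_image_le (s := L) (f := List.drop (2 ^ m))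
        omega)
    have hstep := ih (L.image (List.take (2 ^ m)) ∪ L.image (List.drop (2 ^ m))) (by
      intro l hl
      rcases Finset.mem_union.1 hl with hl | hl <;>
        obtain ⟨l, hl', rfl⟩ := Finset.mem_image.1 hl <;>
        obtain ⟨h1, h2⟩ := hL l hl'
      · exact ⟨by simp, fun p hp => h2 p (List.mem_of_mem_take hp)⟩
      · refine ⟨?_, fun p hp => h2 p (List.mem_of_mem_drop hp)⟩
        rw [List.length_drop]
        rw [pow_succ] at h1
        omega)
    refine (hstep.layer (L.image List.sum) ?_).mono ?_ le_rfl ?_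
    · intro b hb
      obtain ⟨l, hl, rfl⟩ := Finset.mem_image.1 hb
      refine ⟨_, Or.inr ⟨l.take (2 ^ m), ?_, rfl⟩, _, Or.inr ⟨l.drop (2 ^ m), ?_, rfl⟩, Or.inl ?_⟩
      · exact Finset.mem_coe.2 (Finset.mem_union_left _ (Finset.mem_image_of_mem _ hl))
      · exact Finset.mem_coe.2 (Finset.mem_union_right _ (Finset.mem_image_of_mem _ hl))
      · rw [← List.sum_append, List.take_append_drop]
    · have h1 := Finset.card_image_le (s := L) (f := List.sum)
      obtain ⟨c, hc⟩ : ∃ c, 2 ^ m = c + 1 := ⟨2 ^ m - 1, by have := Nat.one_le_two_pow (n := m); omega⟩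
      rw [pow_succ, hc, show (c + 1) * 2 - 1 = 2 * c + 1 by omega, Nat.add_sub_cancel]
      rw [hc] at hcard
      have h2 := Nat.mul_le_mul_right c hcard
      linarith
    · rintro p (hp | ⟨l, hl, rfl⟩)
      · exact Or.inl (Or.inl hp)
      · exact Or.inr (Finset.mem_coe.2 (Finset.mem_image_of_mem _ hl))

theorem Realizable.exists_circuit {s d : ℕ} {A : Set (MvPolynomial X ℕ)} (h : Realizable s d A)
    (h1 : 1 ∈ A) {p : MvPolynomial X ℕ} (hp : p ∈ A) :
    ∃ F : Circuit X, F.poly = p ∧ F.size ≤ s + 1 ∧ F.depth ≤ d + 1 := by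
  obtain ⟨F, hs, hd, hA⟩ := h
  -- The gate carrying `p` may lie anywhere; a final multiplication by `1` moves `p` to the output
  -- position.
  obtain ⟨g, hg, hgd⟩ := exists_snoc (hA p hp) (hA 1 h1) (Or.inr (mul_one p).symm)
    (hd.trans (Nat.le_succ d))
  exact ⟨F.snoc g, hg, Nat.succ_le_succ hs, hgd⟩

end Circuit

end Datalog

namespace Datalog

/-! ### Productions, derivations and contexts

A production `Pr x y z` means that the item `x` is obtained from the items `y` and `z`. The value
of an item is the sum of the values of its derivations. -/

section
variable {V : Type*} (Pr : V → V → V → Prop) (W : Finset V) (star : V)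

/-- `Derivation Pr W e x n a`: the item `x` has a derivation with `n` vertices and with value `a`,
the leaves being items of `W` with the values given by `e`. -/
inductive Derivation {A : Type*} [CommSemiring A] (e : V → A) : V → ℕ → A → Prop
  | leaf {x : V} (hx : x ∈ W) : Derivation e x 1 (e x)
  | node {x y z : V} {m n : ℕ} {a b : A} (h : Pr x y z) (hy : Derivation e y m a)
      (hz : Derivation e z n b) : Derivation e x (m + n + 1) (a * b)

/-- `Context Pr W e x w n a`: there is a derivation of `x` with a hole at a leaf `w`, with `n`
vertices apart from the hole and with value `a`. -/
inductive Context {A : Type*} [CommSemiring A] (e : V → A) : V → V → ℕ → A → Prop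
  | hole {x : V} (hx : x ∈ W) : Context e x x 0 1
  | cons {x y z w : V} {m n : ℕ} {a b : A} (h : Pr x y z) (hy : Context e y w m a)
      (hz : Derivation Pr W e z n b) : Context e x w (m + n + 1) (a * b)

open Classical in
/-- The value of the contexts of `i` with hole `j` (for `j = star`: of the derivations of `i`)
that are found in `k` rounds. A round composes the known contexts and adds the productions with
a known derivation on one side. -/
noncomputable def contextValue {A : Type*} [CommSemiring A] (e : V → A) : ℕ → V → V → A
  | 0, i, j => if i = j then 1 else if j = star then e i else 0
  | k + 1, i, j => ∑ u ∈ W, contextValue e k i u * contextValue e k u j +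
      ∑ u ∈ W, if Pr i j u then contextValue e k u star else 0

variable {Pr W star}

/-- The circuit is built once over the polynomial semiring, which is not idempotent; the order
arguments apply only after evaluation in `S`. -/
theorem map_contextValue {A B : Type*} [CommSemiring A] [CommSemiring B] (f : A →+* B) (e : V → A)
    (k : ℕ) (i j : V) :
    f (contextValue Pr W star e k i j) = contextValue Pr W star (fun x => f (e x)) k i j := by
  induction k generalizing i j with
  | zero =>
    simp only [contextValue]
    split_ifs <;> simp
  | succ k ih =>
    simp only [contextValue, map_add, map_sum, map_mul, ih, apply_ite f, map_zero]

theorem Derivation.map {A B : Type*} [CommSemiring A] [CommSemiring B] (f : A →+* B) {e : V → A}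
    {x : V} {n : ℕ} {a : A} (h : Derivation Pr W e x n a) :
    Derivation Pr W (fun x => f (e x)) x n (f a) := by
  induction h with
  | leaf hx => exact .leaf (e := fun x => f (e x)) hx
  | node h _ _ ihy ihz =>
    rw [map_mul]
    exact .node h ihy ihz

/-! ### Cutting derivations and contexts at a balanced vertex -/

section
variable {A : Type*} [CommSemiring A] {e : V → A}

theorem Derivation.pos {x : V} {n : ℕ} {a : A} (h : Derivation Pr W e x n a) : 1 ≤ n := by
  cases h <;> omega

/-- A derivation with more than `N` vertices has a vertex whose subtree has more than `N` vertices
while the subtrees of its children have at most `N` vertices. -/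
theorem Derivation.exists_centroid (hW : ∀ x y z, Pr x y z → x ∈ W)
    (hsymm : ∀ x y z, Pr x y z → Pr x z y) {N : ℕ} (hN : 1 ≤ N) {x : V} {n : ℕ} {a : A}
    (h : Derivation Pr W e x n a) :
    n ≤ N ∨ ∃ w y z c p q a₀ a₁ a₂, Context Pr W e x w c a₀ ∧ Pr w y z ∧
      Derivation Pr W e y p a₁ ∧ Derivation Pr W e z q a₂ ∧ a = a₀ * (a₁ * a₂) ∧
      p ≤ N ∧ q ≤ N ∧ c + (p + q + 1) = n ∧ N < p + q + 1 := by
  induction h with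
  | leaf _ => exact Or.inl hN
  | @node x y z m n a b h hy hz ihy ihz =>
    rcases ihy with hm | ⟨w, y', z', c, p, q, a₀, a₁, a₂, hc, hp, h1, h2, rfl, hpN, hqN, hs, hl⟩
    · rcases ihz with hn | ⟨w, y', z', c, p, q, a₀, a₁, a₂, hc, hp, h1, h2, rfl, hpN, hqN, hs, hl⟩
      · by_cases hmn : m + n + 1 ≤ N
        · exact Or.inl hmn
        · exact Or.inr ⟨x, y, z, 0, m, n, 1, a, b, .hole (hW _ _ _ h), h, hy, hz,
            (one_mul _).symm, hm, hn, by omega, by omega⟩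
      -- `Context.cons` puts the hole in the first premise, so descending into the second one uses
      -- the symmetry of `Pr`.
      · exact Or.inr ⟨w, y', z', _, p, q, _, a₁, a₂, .cons (hsymm _ _ _ h) hc hy, hp, h1, h2,
          by ring, hpN, hqN, by omega, hl⟩
    · exact Or.inr ⟨w, y', z', _, p, q, _, a₁, a₂, .cons h hc hz, hp, h1, h2,
        by ring, hpN, hqN, by omega, hl⟩

/-- A context with more than `N` vertices can be split at a vertex of its spine such that the part
below it has at most `N` vertices, but more than `N` together with the side tree. -/
theorem Context.exists_split (hW : ∀ x y z, Pr x y z → x ∈ W) {N : ℕ} {x w : V} {n : ℕ} {a : A}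
    (h : Context Pr W e x w n a) :
    n ≤ N ∨ ∃ u y z c₁ q c₂ a₁ b a₂, Context Pr W e x u c₁ a₁ ∧ Pr u y z ∧
      Derivation Pr W e z q b ∧ Context Pr W e y w c₂ a₂ ∧ a = a₁ * (b * a₂) ∧
      c₁ + (q + 1 + c₂) = n ∧ c₂ ≤ N ∧ N < q + 1 + c₂ := by
  induction h with
  | hole _ => exact Or.inl (Nat.zero_le _)
  | @cons x y z w m n a b h hy hz ih =>
    rcases ih with hm | ⟨u, y', z', c₁, q, c₂, a₁, b', a₂, h1, hp, h2, h3, rfl, hs, hc, hl⟩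
    · by_cases hmn : m + n + 1 ≤ N
      · exact Or.inl hmn
      · exact Or.inr ⟨x, y, z, 0, n, m, 1, b, a, .hole (hW _ _ _ h), h, hz, hy, by ring,
          by omega, hm, by omega⟩
    · exact Or.inr ⟨u, y', z', _, q, c₂, _, b', a₂, .cons h h1 hz, hp, h2, h3, by ring,
        by omega, hc, hl⟩

end

/-! ### Soundness and completeness of the rounds over an idempotent semiring -/

section
variable {S : Type*} [IdemCommSemiring S] {e : V → S}

theorem sum_le_of_forall_le {ι : Type*} {s : Finset ι} {f : ι → S} {c : S}
    (h : ∀ i ∈ s, f i ≤ c) : ∑ i ∈ s, f i ≤ c :=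
  Finset.sum_induction f (· ≤ c) (fun _ _ ha hb => add_le ha hb) (by simp) h

theorem le_sum_of_mem {ι : Type*} {s : Finset ι} (f : ι → S) {i : ι} (hi : i ∈ s) :
    f i ≤ ∑ i ∈ s, f i :=
  Finset.single_le_sum_of_canonicallyOrdered hi

/-- Soundness: the values are bounded by every family `U` that is closed under productions. -/
theorem contextValue_mul_le {U : V → S} (hstar : U star = 1) (he : ∀ x, e x ≤ U x)
    (hU : ∀ x y z, Pr x y z → U y * U z ≤ U x) (k : ℕ) (i j : V) :
    contextValue Pr W star e k i j * U j ≤ U i := by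
  induction k generalizing i j with
  | zero =>
    simp only [contextValue]
    split_ifs with h1 h2
    · rw [h1, one_mul]
    · rw [h2, hstar, mul_one]
      exact he i
    · simp
  | succ k ih =>
    simp only [contextValue, add_mul, Finset.sum_mul]
    refine add_le (sum_le_of_forall_le fun u _ => ?_) (sum_le_of_forall_le fun u _ => ?_)
    · rw [mul_assoc]
      exact (mul_le_mul_right (ih u j) _).trans (ih i u)
    · split_ifs with h
      · have := ih u star
        rw [hstar, mul_one] at this
        rw [mul_comm]
        exact (mul_le_mul_right this _).trans (hU _ _ _ h)
      · simp

theorem one_le_contextValue_self {i : V} (hi : i ∈ W) (k : ℕ) :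
    1 ≤ contextValue Pr W star e k i i := by
  induction k with
  | zero => simp [contextValue]
  | succ k ih =>
    simp only [contextValue]
    refine le_trans ?_ (le_self_add.trans' (le_sum_of_mem _ hi))
    rw [← one_mul (1 : S)]
    exact mul_le_mul' ih ih

theorem mul_le_contextValue_succ {u : V} (hu : u ∈ W) (k : ℕ) (i j : V) :
    contextValue Pr W star e k i u * contextValue Pr W star e k u j ≤
      contextValue Pr W star e (k + 1) i j := by
  simp only [contextValue]
  exact le_self_add.trans' (le_sum_of_mem (fun u => contextValue Pr W star e k i u *
    contextValue Pr W star e k u j) hu)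

theorem le_contextValue_succ_of_production {i j u : V} (hu : u ∈ W) (h : Pr i j u) (k : ℕ) :
    contextValue Pr W star e k u star ≤ contextValue Pr W star e (k + 1) i j := by
  classical
  simp only [contextValue]
  refine le_trans ?_ (le_add_self.trans' (le_sum_of_mem _ hu))
  rw [if_pos h]

theorem contextValue_mono {i : V} (hi : i ∈ W) (j : V) :
    Monotone fun k => contextValue Pr W star e k i j := by
  refine monotone_nat_of_le_succ fun k => ?_
  refine le_trans ?_ (mul_le_contextValue_succ hi k i j)
  nth_rewrite 1 [← one_mul (contextValue Pr W star e k i j)]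
  exact mul_le_mul' (one_le_contextValue_self hi k) le_rfl

/-- Completeness: derivations and contexts with at most `2 ^ k` vertices are found in
`4 * k + 3` rounds. -/
theorem le_contextValue (hone : ∀ x : S, x ≤ 1)
    (hW : ∀ x y z, Pr x y z → x ∈ W ∧ y ∈ W ∧ z ∈ W)
    (hsymm : ∀ x y z, Pr x y z → Pr x z y) (k : ℕ) :
    (∀ x n a, Derivation Pr W e x n a → n ≤ 2 ^ k →
      a ≤ contextValue Pr W star e (4 * k) x star) ∧
    (∀ x w n a, Context Pr W e x w n a → n ≤ 2 ^ k →
      a ≤ contextValue Pr W star e (4 * k + 3) x w) := by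
  have hW' : ∀ x y z, Pr x y z → x ∈ W := fun x y z h => (hW x y z h).1
  induction k with
  | zero =>
    refine ⟨fun x n a h hn => ?_, fun x w n a h hn => ?_⟩
    · cases h with
      | leaf hx =>
        -- For `x = star` the diagonal entry is `1` rather than `e star`, which is still an upper
        -- bound.
        simp only [contextValue]
        split_ifs
        · exact hone _
        · exact le_rfl
      | node _ hy hz =>
        have := hy.pos
        have := hz.pos
        simp at hn
        omega
    · cases h with
      | hole hx => exact one_le_contextValue_self hx _
      | cons _ _ hz =>
        have := hz.pos
        simp at hn
        omega
  | succ k ih =>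
    obtain ⟨ihD, ihC⟩ := ih
    have hpow : 2 ^ (k + 1) = 2 ^ k + 2 ^ k := by ring
    have hD : ∀ x n a, Derivation Pr W e x n a → n ≤ 2 ^ (k + 1) →
        a ≤ contextValue Pr W star e (4 * (k + 1)) x star := by
      intro x n a h hn
      rcases h.exists_centroid hW' hsymm (Nat.one_le_two_pow (n := k)) with
        hs | ⟨w, y, z, c, p, q, a₀, a₁, a₂, hc, hp, h1, h2, rfl, hpN, hqN, hs, hl⟩
      · have hx : x ∈ W := by
          cases h with
          | leaf hx => exact hx
          | node h => exact hW' _ _ _ h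
        exact (ihD x n a h hs).trans (contextValue_mono hx star (by omega))
      · have hw := hW _ _ _ hp
        -- Subtrees of size at most `2 ^ k` are known at round `4 * k`. The next round turns the
        -- subtree of `z` into a context from `w` to `y`, and one more attaches the subtree of `y`.
        -- The context above `w` has fewer than `2 ^ k` vertices and is known at round `4 * k + 3`;
        -- the fourth round joins it.
        have e1 : a₂ ≤ contextValue Pr W star e (4 * k + 1) w y :=
          (ihD _ _ _ h2 hqN).trans (le_contextValue_succ_of_production hw.2.2 hp _)
        have e2 : a₁ ≤ contextValue Pr W star e (4 * k + 1) y star :=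
          (ihD _ _ _ h1 hpN).trans (contextValue_mono hw.2.1 star (by omega))
        have e3 : a₁ * a₂ ≤ contextValue Pr W star e (4 * k + 3) w star := by
          rw [mul_comm]
          exact ((mul_le_mul' e1 e2).trans (mul_le_contextValue_succ hw.2.1 _ _ _)).trans
            (contextValue_mono hw.1 star (by omega))
        exact (mul_le_mul' (ihC _ _ _ _ hc (by omega)) e3).trans
          (mul_le_contextValue_succ hw.1 _ _ _)
    refine ⟨hD, fun x w n a h hn => ?_⟩
    have hx : x ∈ W := by
      cases h with
      | hole hx => exact hx
      | cons h => exact hW' _ _ _ h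
    rcases h.exists_split hW' (N := 2 ^ k) with
      hs | ⟨u, y, z, c₁, q, c₂, a₁, b, a₂, h1, hp, h2, h3, rfl, hs, hc, hl⟩
    · exact (ihC x w n a h hs).trans (contextValue_mono hx w (by omega))
    · have hw := hW _ _ _ hp
      -- The side tree can have almost `2 ^ (k + 1)` vertices, so it needs the derivation bound `hD`
      -- for `k + 1`. This is why contexts lag three rounds behind derivations: one-step context,
      -- lower part, upper part.
      have e1 : b ≤ contextValue Pr W star e (4 * (k + 1) + 1) u y :=
        (hD _ _ _ h2 (by omega)).trans (le_contextValue_succ_of_production hw.2.2 hp _)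
      have e2 : a₂ ≤ contextValue Pr W star e (4 * (k + 1) + 1) y w :=
        (ihC _ _ _ _ h3 hc).trans (contextValue_mono hw.2.1 w (by omega))
      have e3 : b * a₂ ≤ contextValue Pr W star e (4 * (k + 1) + 2) u w :=
        (mul_le_mul' e1 e2).trans (mul_le_contextValue_succ hw.2.1 _ _ _)
      have e4 : a₁ ≤ contextValue Pr W star e (4 * (k + 1) + 2) x u :=
        (ihC _ _ _ _ h1 (by omega)).trans (contextValue_mono hx u (by omega))
      exact (mul_le_mul' e4 e3).trans (mul_le_contextValue_succ hw.1 _ _ _)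

end

/-- A round costs `|W| ^ 3 + |W| ^ 2 * 2 ^ m` gates and depth `m + 1`, where `2 * |W| ≤ 2 ^ m`. -/
theorem realizable_contextValue {X : Type*} {e : V → MvPolynomial X ℕ}
    (he : ∀ x, e x = 0 ∨ e x = 1 ∨ ∃ i, e x = MvPolynomial.X i) (hstar : star ∈ W) {m : ℕ}
    (hm : 2 * W.card ≤ 2 ^ m) (k : ℕ) :
    Circuit.Realizable (3 + W.card ^ 2 + k * (W.card ^ 3 + W.card ^ 2 * 2 ^ m)) (k * (m + 1))
      {p | p = 0 ∨ p = 1 ∨ ∃ i ∈ W, ∃ j ∈ W, p = contextValue Pr W star e k i j} := by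
  classical
  induction k with
  | zero =>
    refine (Circuit.realizable_input ({0, 1} ∪ (W ×ˢ W).image fun x =>
      contextValue Pr W star e 0 x.1 x.2) ?_).mono ?_ (Nat.zero_le _) ?_
    · intro b hb
      simp only [Finset.mem_union, Finset.mem_insert, Finset.mem_singleton, Finset.mem_image] at hb
      rcases hb with (rfl | rfl) | ⟨x, -, rfl⟩
      · exact Or.inl rfl
      · exact Or.inr (Or.inl rfl)
      · simp only [contextValue]
        split_ifs
        · exact Or.inr (Or.inl rfl)
        · exact he _
        · exact Or.inl rfl
    · have h1 := Finset.card_union_le ({0, 1} : Finset (MvPolynomial X ℕ))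
        ((W ×ˢ W).image fun x => contextValue Pr W star e 0 x.1 x.2)
      have h2 := Finset.card_image_le (s := W ×ˢ W)
        (f := fun x => contextValue Pr W star e 0 x.1 x.2)
      have h3 := Finset.card_le_two (a := (0 : MvPolynomial X ℕ)) (b := 1)
      rw [Finset.card_product, ← sq] at h2
      omega
    · rintro p (rfl | rfl | ⟨i, hi, j, hj, rfl⟩)
      · simp
      · simp
      · refine Finset.mem_coe.2 (Finset.mem_union_right _ (Finset.mem_image.2
          ⟨(i, j), Finset.mem_product.2 ⟨hi, hj⟩, rfl⟩))
  | succ k ih =>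
    set M := contextValue Pr W star e k with hM
    have h1 := ih.layer ((W ×ˢ W ×ˢ W).image fun x => M x.1 x.2.1 * M x.2.1 x.2.2) (by
      intro b hb
      obtain ⟨⟨i, u, j⟩, hx, rfl⟩ := Finset.mem_image.1 hb
      simp only [Finset.mem_product] at hx
      exact ⟨_, Or.inr (Or.inr ⟨i, hx.1, u, hx.2.1, rfl⟩), _,
        Or.inr (Or.inr ⟨u, hx.2.1, j, hx.2.2, rfl⟩), Or.inr rfl⟩)
    -- Both sums of a round are merged into one list of `2 * |W|` terms. The case distinction on
    -- `Pr` is made while building the circuit and costs no gate.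
    have h2 := h1.sums (Or.inl (Or.inl rfl)) m ((W ×ˢ W).image fun x =>
        (W.toList.map fun u => M x.1 u * M u x.2) ++
          W.toList.map fun u => if Pr x.1 x.2 u then M u star else 0) (by
      intro l hl
      obtain ⟨⟨i, j⟩, hx, rfl⟩ := Finset.mem_image.1 hl
      simp only [Finset.mem_product] at hx
      refine ⟨by simpa [two_mul] using hm, fun p hp => ?_⟩
      rcases List.mem_append.1 hp with hp | hp <;> obtain ⟨u, hu, rfl⟩ := List.mem_map.1 hp <;>
        rw [Finset.mem_toList] at hu
      · exact Or.inr (Finset.mem_coe.2 (Finset.mem_image.2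
          ⟨(i, u, j), by simp [hx, hu], rfl⟩))
      · left
        dsimp only
        split_ifs
        · exact Or.inr (Or.inr ⟨u, hu, star, hstar, rfl⟩)
        · exact Or.inl rfl)
    refine h2.mono ?_ (by linarith) ?_
    · have c1 := Finset.card_image_le (s := W ×ˢ W ×ˢ W)
        (f := fun x => M x.1 x.2.1 * M x.2.1 x.2.2)
      have c2 := Finset.card_image_le (s := W ×ˢ W) (f := fun x =>
        (W.toList.map fun u => M x.1 u * M u x.2) ++
          W.toList.map fun u => if Pr x.1 x.2 u then M u star else 0)
      rw [Finset.card_product, Finset.card_product] at c1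
      rw [Finset.card_product] at c2
      have c3 := Nat.mul_le_mul c2 (Nat.sub_le (2 ^ m) 1)
      have c4 : W.card ^ 3 = W.card * (W.card * W.card) := by ring
      have c5 : W.card ^ 2 = W.card * W.card := by ring
      rw [add_mul, c4, c5]
      omega
    · rintro p (rfl | rfl | ⟨i, hi, j, hj, rfl⟩)
      · exact Or.inl (Or.inl (Or.inl rfl))
      · exact Or.inl (Or.inl (Or.inr (Or.inl rfl)))
      · refine Or.inr ⟨_, Finset.mem_coe.2 (Finset.mem_image.2
          ⟨(i, j), Finset.mem_product.2 ⟨hi, hj⟩, rfl⟩), ?_⟩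
        rw [List.sum_append, Finset.sum_map_toList, Finset.sum_map_toList]
        simp only [contextValue, hM]

end
end Datalog

namespace Datalog
variable {R C : Type*} {ar : R → ℕ}

/-! ### Proof trees and provenance -/

namespace FactTree
variable {P : Program ar C} {I : Finset (Fact ar C)}

theorem exists_subtree {a : Fact ar C} (t : FactTree I) (hd : t.Derives P) (ht : t.IsTight)
    (ha : a ∈ t.internalLabels) :
    ∃ s : FactTree I, s.IsProofTree P a ∧ s.IsTight ∧ s.monomial ∣ t.monomial := by
  induction t with
  | leaf b => exact ha.elim
  | node b n c ih =>
    rcases ha with rfl | ha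
    · exact ⟨_, ⟨rfl, hd⟩, ht, dvd_rfl⟩
    · obtain ⟨i, hi⟩ := Set.mem_iUnion.1 ha
      obtain ⟨s, h1, h2, h3⟩ := ih i (hd.2 i) (ht.2 i) hi
      exact ⟨s, h1, h2, h3.trans (Finset.dvd_prod_of_mem (fun i => (c i).monomial)
        (Finset.mem_univ i))⟩

/-- Cutting out the part between two internal vertices with the same label makes a proof tree
tight; the monomial of the result divides the original one. -/
theorem exists_tight (t : FactTree I) (hd : t.Derives P) :
    ∃ s : FactTree I, s.IsProofTree P t.label ∧ s.IsTight ∧ s.monomial ∣ t.monomial := by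
  induction t with
  | leaf b => exact ⟨_, ⟨rfl, hd⟩, trivial, dvd_rfl⟩
  | node a n c ih =>
    choose s h1 h2 h3 using fun i => ih i (hd.2 i)
    have hdvd : (node a n s).monomial ∣ (node a n c).monomial :=
      Finset.prod_dvd_prod_of_dvd _ _ fun i _ => h3 i
    by_cases ha : ∃ i, a ∈ (s i).internalLabels
    · obtain ⟨i, hi⟩ := ha
      obtain ⟨u, hu1, hu2, hu3⟩ := exists_subtree (s i) (h1 i).2 (h2 i) hi
      exact ⟨u, hu1, hu2, (hu3.trans (Finset.dvd_prod_of_mem (fun i => (s i).monomial)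
        (Finset.mem_univ i))).trans hdvd⟩
    · refine ⟨node a n s, ⟨rfl, ?_, fun i => (h1 i).2⟩, ⟨not_exists.1 ha, h2⟩, hdvd⟩
      have : (fun i => (s i).label) = fun i => (c i).label := funext fun i => (h1 i).1
      rw [this]
      exact hd.1

end FactTree

section
variable {S : Type*} [IdemCommSemiring S] {P : Program ar C} {I : Finset (Fact ar C)}

theorem le_of_dvd_of_le_one (hone : ∀ x : S, x ≤ 1) {a b : S} (h : a ∣ b) : b ≤ a := by
  obtain ⟨c, rfl⟩ := h
  simpa using mul_le_mul' (le_refl a) (hone c)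

theorem aeval_monomial_le_provenance (hone : ∀ x : S, x ≤ 1) (v : {a // a ∈ I} → S)
    {a : Fact ar C} {t : FactTree I} (ht : t.IsProofTree P a) :
    MvPolynomial.aeval v t.monomial ≤ MvPolynomial.aeval v (P.provenance I a) := by
  obtain ⟨s, h1, h2, h3⟩ := t.exists_tight ht.2
  rw [ht.1] at h1
  refine (le_of_dvd_of_le_one hone (map_dvd (MvPolynomial.aeval v) h3)).trans ?_
  rw [Program.provenance, map_sum]
  exact le_sum_of_mem (fun t : FactTree I => MvPolynomial.aeval v t.monomial) (by simp [h1, h2])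

/-- Expanding the product chooses a tight tree for every body atom. Joining them under the head
gives a proof tree that need not be tight, but it is absorbed by `aeval_monomial_le_provenance`. -/
theorem prod_provenance_le (hone : ∀ x : S, x ≤ 1) (v : {a // a ∈ I} → S) {g : Rule ar C}
    (hg : g ∈ P.grounding I) :
    (g.body.map fun b => MvPolynomial.aeval v (P.provenance I b)).prod ≤
      MvPolynomial.aeval v (P.provenance I g.head) := by
  classical
  have : (g.body.map fun b => MvPolynomial.aeval v (P.provenance I b)).prod =
      ∏ i : Fin g.body.length, MvPolynomial.aeval v (P.provenance I (g.body.get i)) := by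
    rw [← List.prod_ofFn]
    congr 1
    exact List.ext_get (by simp) (by simp)
  rw [this]
  simp only [Program.provenance, map_sum]
  rw [Finset.prod_univ_sum]
  refine sum_le_of_forall_le fun c hc => ?_
  simp only [Fintype.mem_piFinset, Set.Finite.mem_toFinset, Set.mem_ofPred_eq] at hc
  have ht : (FactTree.node g.head g.body.length c).IsProofTree P g.head := by
    refine ⟨rfl, ?_, fun i => (hc i).1.2⟩
    have : (List.ofFn fun i => (c i).label) = g.body := by
      rw [funext fun i => (hc i).1.1, List.ofFn_get]
    rw [this]
    exact hg
  have := aeval_monomial_le_provenance hone v ht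
  simpa only [FactTree.monomial, map_prod, Program.provenance, map_sum] using this

end

/-! ### Conjunctions of facts as items -/

/-- A conjunction is the product of its first fact and the rest; a fact is derived by a grounding
of a rule from the body. -/
inductive Step (P : Program ar C) (I : Finset (Fact ar C)) :
    List (Fact ar C) → List (Fact ar C) → List (Fact ar C) → Prop
  | split (b : Fact ar C) (l : List (Fact ar C)) : Step P I (b :: l) [b] l
  | rule (g : Rule ar C) (hg : g ∈ P.grounding I) : Step P I [g.head] g.body []

/-- The steps, in both orders of their premises, that stay inside of `W`. -/
def Production (P : Program ar C) (I : Finset (Fact ar C)) (W : Finset (List (Fact ar C)))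
    (x y z : List (Fact ar C)) : Prop :=
  (x ∈ W ∧ y ∈ W ∧ z ∈ W) ∧ (Step P I x y z ∨ Step P I x z y)

open Classical in
/-- The value of an item that needs no derivation. -/
noncomputable def leafValue (I : Finset (Fact ar C)) :
    List (Fact ar C) → MvPolynomial {a // a ∈ I} ℕ
  | [] => 1
  | [b] => if h : b ∈ I then MvPolynomial.X ⟨b, h⟩ else 0
  | _ => 0

theorem leafValue_eq (I : Finset (Fact ar C)) (l : List (Fact ar C)) :
    leafValue I l = 0 ∨ leafValue I l = 1 ∨ ∃ i, leafValue I l = MvPolynomial.X i := by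
  match l with
  | [] => exact Or.inr (Or.inl rfl)
  | [b] =>
    by_cases h : b ∈ I
    · exact Or.inr (Or.inr ⟨⟨b, h⟩, by simp [leafValue, h]⟩)
    · exact Or.inl (by simp [leafValue, h])
  | _ :: _ :: _ => exact Or.inl rfl

/-! ### Items compared with proof trees -/

section
variable {P : Program ar C} {I : Finset (Fact ar C)} {W : Finset (List (Fact ar C))}

/-- Soundness applied to the family that sends a conjunction to the product of the provenances of
its facts; the empty conjunction gets `1`, as required of `star`. -/
theorem contextValue_le_provenance {S : Type*} [IdemCommSemiring S] (hone : ∀ x : S, x ≤ 1)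
    (v : {a // a ∈ I} → S) (k : ℕ) (a : Fact ar C) :
    contextValue (Production P I W) W []
      (fun l => MvPolynomial.aeval v (leafValue I l)) k [a] [] ≤
      MvPolynomial.aeval v (P.provenance I a) := by
  set U : List (Fact ar C) → S := fun l =>
    (l.map fun b => MvPolynomial.aeval v (P.provenance I b)).prod with hU
  have hstep : ∀ x y z, Step P I x y z → U y * U z ≤ U x := by
    rintro _ _ _ (⟨b, l⟩ | ⟨g, hg⟩)
    · simp [hU]
    · simpa [hU] using prod_provenance_le hone v hg
  have := contextValue_mul_le (Pr := Production P I W) (W := W) (star := [])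
    (e := fun l => MvPolynomial.aeval v (leafValue I l)) (U := U) (by simp [hU]) ?_ ?_ k [a] []
  · simpa [hU] using this
  · intro l
    match l with
    | [] => simp [hU, leafValue]
    | [b] =>
      by_cases h : b ∈ I
      · have := aeval_monomial_le_provenance (P := P) hone v (a := b) (t := .leaf ⟨b, h⟩)
          ⟨rfl, trivial⟩
        simpa [hU, leafValue, h, FactTree.monomial] using this
      · simp [leafValue, h]
    | _ :: _ :: _ => simp [leafValue]
  · rintro x y z ⟨-, h | h⟩
    · exact hstep _ _ _ h
    · rw [mul_comm]
      exact hstep _ _ _ h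

/-- The items needed for the proof trees of the facts `a` with `[a] ∈ W`. -/
structure IsClosed (P : Program ar C) (I : Finset (Fact ar C)) (W : Finset (List (Fact ar C))) :
    Prop where
  nil_mem : [] ∈ W
  body_mem : ∀ g ∈ P.grounding I, g.body ∈ W
  tail_mem : ∀ b l, b :: l ∈ W → l ∈ W
  singleton_mem : ∀ b l, b :: l ∈ W → [b] ∈ W

/-- Each tree's bound leaves one vertex to spare, which pays for the split that detaches it from the
list; the initial `1` is the leaf `[]`. -/
theorem exists_forest_derivation (hW : IsClosed P I W) {n : ℕ} (c : Fin n → FactTree I)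
    (hc : ∀ i, [(c i).label] ∈ W → ∃ m, m + 1 ≤ 4 * (c i).size ∧
      Derivation (Production P I W) W (leafValue I) [(c i).label] m (c i).monomial)
    (hmem : (List.ofFn fun i => (c i).label) ∈ W) :
    ∃ m, m ≤ 1 + 4 * ∑ i, (c i).size ∧ Derivation (Production P I W) W (leafValue I)
      (List.ofFn fun i => (c i).label) m (∏ i, (c i).monomial) := by
  induction n with
  | zero => exact ⟨1, by simp, by simpa [leafValue] using Derivation.leaf (e := leafValue I) hW.nil_mem⟩
  | succ n ih =>
    rw [List.ofFn_succ] at hmem ⊢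
    have h1 := hW.singleton_mem _ _ hmem
    have h2 := hW.tail_mem _ _ hmem
    obtain ⟨p, hp, hD⟩ := hc 0 h1
    obtain ⟨q, hq, hD'⟩ := ih (fun i => c i.succ) (fun i => hc i.succ) h2
    refine ⟨p + q + 1, ?_, ?_⟩
    · rw [Fin.sum_univ_succ]
      omega
    · rw [Fin.prod_univ_succ]
      exact .node ⟨⟨hmem, h1, h2⟩, Or.inl (.split _ _)⟩ hD hD'

theorem exists_derivation (hW : IsClosed P I W) (t : FactTree I) (hd : t.Derives P)
    (ht : [t.label] ∈ W) : ∃ m, m + 1 ≤ 4 * t.size ∧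
      Derivation (Production P I W) W (leafValue I) [t.label] m t.monomial := by
  induction t with
  | leaf a =>
    refine ⟨1, by simp [FactTree.size], ?_⟩
    have := Derivation.leaf (Pr := Production P I W) (e := leafValue I) ht
    simpa [FactTree.label, leafValue, FactTree.monomial] using this
  | node a n c ih =>
    have hb := hW.body_mem _ hd.1
    obtain ⟨m, hm, hD⟩ := exists_forest_derivation hW c (fun i => ih i (hd.2 i)) hb
    -- The two extra vertices are the item of the head and the premise `[]` that pads the rule to a
    -- binary production.
    refine ⟨m + 1 + 1, ?_, ?_⟩
    · simp only [FactTree.size]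
      omega
    · have := Derivation.node ⟨⟨ht, hb, hW.nil_mem⟩, Or.inl (.rule _ hd.1)⟩ hD
        (.leaf hW.nil_mem)
      simpa [leafValue, FactTree.monomial] using this

theorem provenance_le_contextValue {S : Type*} [IdemCommSemiring S] (hone : ∀ x : S, x ≤ 1)
    (hW : IsClosed P I W) (v : {a // a ∈ I} → S) {a : Fact ar C} (ha : [a] ∈ W) {k : ℕ}
    (hk : ∀ t : FactTree I, t.IsProofTree P a → t.IsTight → 4 * t.size ≤ 2 ^ k) :
    MvPolynomial.aeval v (P.provenance I a) ≤ contextValue (Production P I W) W []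
      (fun l => MvPolynomial.aeval v (leafValue I l)) (4 * k) [a] [] := by
  rw [Program.provenance, map_sum]
  refine sum_le_of_forall_le fun t ht => ?_
  simp only [Set.Finite.mem_toFinset, Set.mem_ofPred_eq] at ht
  obtain ⟨⟨rfl, hd⟩, htight⟩ := ht
  obtain ⟨m, hm, hD⟩ := exists_derivation hW t hd ha
  have := hk t ⟨rfl, hd⟩ htight
  exact (le_contextValue hone (fun x y z h => h.1)
    (fun x y z h => ⟨⟨h.1.1, h.1.2.2, h.1.2.1⟩, h.2.symm⟩) k).1 _ _ _
    (hD.map (MvPolynomial.aeval v : MvPolynomial {a // a ∈ I} ℕ →ₐ[ℕ] S).toRingHom) (by omega)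

/-- The circuit for the provenance polynomial, with explicit bounds. -/
theorem exists_circuit_provenance {S : Type*} [CommSemiring S] (hS : IsAbsorptive S)
    (hW : IsClosed P I W) {a : Fact ar C} (ha : [a] ∈ W) {k m : ℕ} (hm : 2 * W.card ≤ 2 ^ m)
    (hk : ∀ t : FactTree I, t.IsProofTree P a → t.IsTight → 4 * t.size ≤ 2 ^ k) :
    ∃ F : Circuit {a // a ∈ I}, F.Computes S (P.provenance I a) ∧
      F.size ≤ 3 + W.card ^ 2 + 4 * k * (W.card ^ 3 + W.card ^ 2 * 2 ^ m) + 1 ∧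
      F.depth ≤ 4 * k * (m + 1) + 1 := by
  obtain ⟨F, h1, h2, h3⟩ := (realizable_contextValue (Pr := Production P I W)
    (leafValue_eq I) hW.nil_mem hm (4 * k)).exists_circuit (Or.inr (Or.inl rfl))
    (Or.inr (Or.inr ⟨[a], ha, [], hW.nil_mem, rfl⟩))
  refine ⟨F, fun v => ?_, h2, h3⟩
  have hidem : ∀ x : S, x + x = x := fun x => by
    rw [← mul_one x, ← mul_add, hS 1]
  -- The order it carries is `a ≤ b ↔ a + b = b`; absorption says that `1` is its top element.
  let _ : IdemCommSemiring S :=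
    { ‹CommSemiring S›, IdemSemiring.ofSemiring hidem with }
  have hone : ∀ x : S, x ≤ 1 := fun x => by
    rw [← add_eq_right_iff_le, add_comm]
    exact hS x
  rw [h1]
  have key := map_contextValue (Pr := Production P I W) (W := W) (star := [])
    (MvPolynomial.aeval v : MvPolynomial {a // a ∈ I} ℕ →ₐ[ℕ] S).toRingHom (leafValue I)
    (4 * k) [a] []
  exact key.trans (le_antisymm (contextValue_le_provenance hone v _ a)
    (provenance_le_contextValue hone hW v ha hk))

end

end Datalog

namespace Datalog
variable {R C : Type*} {ar : R → ℕ}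

/-! ### Polynomial bounds -/

/-- `f I` is polynomially bounded in the number of facts of the input `I`. -/
def PolyBounded (P : Program ar C) (f : Finset (Fact ar C) → ℕ) : Prop :=
  ∃ d : ℕ, ∀ I, P.IsInput I → f I ≤ (I.card + 2) ^ d

namespace PolyBounded
variable {P : Program ar C} {f g : Finset (Fact ar C) → ℕ}

theorem mono (hf : PolyBounded P f) (h : ∀ I, P.IsInput I → g I ≤ f I) : PolyBounded P g := by
  obtain ⟨d, hd⟩ := hf
  exact ⟨d, fun I hI => (h I hI).trans (hd I hI)⟩

theorem const (c : ℕ) : PolyBounded P fun _ => c :=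
  ⟨c, fun I _ => Nat.lt_two_pow_self.le.trans (Nat.pow_le_pow_left (by omega) c)⟩

theorem card : PolyBounded P Finset.card :=
  ⟨1, fun I _ => by rw [pow_one]; omega⟩

theorem mul (hf : PolyBounded P f) (hg : PolyBounded P g) : PolyBounded P fun I => f I * g I := by
  obtain ⟨d, hd⟩ := hf
  obtain ⟨e, he⟩ := hg
  exact ⟨d + e, fun I hI => by
    rw [pow_add]
    exact Nat.mul_le_mul (hd I hI) (he I hI)⟩

theorem add (hf : PolyBounded P f) (hg : PolyBounded P g) : PolyBounded P fun I => f I + g I := by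
  obtain ⟨d, hd⟩ := hf
  obtain ⟨e, he⟩ := hg
  refine ⟨d + e + 1, fun I hI => ?_⟩
  -- The base is at least `2`, so one extra factor absorbs the sum of two equal powers.
  have h1 : (I.card + 2) ^ d ≤ (I.card + 2) ^ (d + e) := Nat.pow_le_pow_right (by omega) (by omega)
  have h2 : (I.card + 2) ^ e ≤ (I.card + 2) ^ (d + e) := Nat.pow_le_pow_right (by omega) (by omega)
  have h3 := hd I hI
  have h4 := he I hI
  rw [pow_succ]
  nlinarith

theorem pow (hf : PolyBounded P f) (n : ℕ) : PolyBounded P fun I => f I ^ n := by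
  obtain ⟨d, hd⟩ := hf
  exact ⟨d * n, fun I hI => by
    rw [pow_mul]
    exact Nat.pow_le_pow_left (hd I hI) n⟩

theorem sum {ι : Type*} (s : Finset ι) {f : ι → Finset (Fact ar C) → ℕ}
    (hf : ∀ i ∈ s, PolyBounded P (f i)) : PolyBounded P fun I => ∑ i ∈ s, f i I := by
  classical
  induction s using Finset.induction_on with
  | empty => simpa using const 0
  | insert i s hi ih =>
    simp only [Finset.sum_insert hi]
    exact (hf i (Finset.mem_insert_self _ _)).add
      (ih fun j hj => hf j (Finset.mem_insert_of_mem hj))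

theorem eval (q : Polynomial ℕ) : PolyBounded P fun I => q.eval I.card := by
  simp only [Polynomial.eval_eq_sum, Polynomial.sum]
  exact sum _ fun i _ => (const _).mul (card.pow i)

end PolyBounded

namespace Program
variable (P : Program ar C)

/-- A bound on the arities of the extensional predicates. -/
def arityBound : ℕ := ∑ r ∈ P.rules, (r.body.map fun a => ar a.rel).sum

/-- A bound on the number of atoms in the body of a rule. -/
def widthBound : ℕ := ∑ r ∈ P.rules, r.body.length

variable {P}

theorem arity_le {p : R} (hp : P.IsEDB p) : ar p ≤ P.arityBound := by
  obtain ⟨⟨r, hr, a, ha, rfl⟩, -⟩ := hp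
  exact (List.single_le_sum (by simp) _ (List.mem_map_of_mem (f := fun a => ar a.rel) ha)).trans
    (Finset.single_le_sum (f := fun r => (r.body.map fun a => ar a.rel).sum) (by simp) hr)

theorem length_body_le {I : Finset (Fact ar C)} {g : Rule ar C} (hg : g ∈ P.grounding I) :
    g.body.length ≤ P.widthBound := by
  obtain ⟨r, hr, ν, -, rfl⟩ := hg
  simp only [Rule.map, List.length_map]
  exact Finset.single_le_sum (f := fun r => r.body.length) (by simp) hr

theorem ncard_activeDomain_le {I : Finset (Fact ar C)} (hI : P.IsInput I) :
    (activeDomain I).ncard ≤ I.card * P.arityBound := by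
  classical
  have : activeDomain I = ↑(I.biUnion fun a => Finset.univ.image a.args) := by
    ext c
    simp [activeDomain]
  rw [this, Set.ncard_coe_finset]
  refine Finset.card_biUnion_le_card_mul _ _ _ fun a ha => ?_
  exact Finset.card_image_le.trans (by simpa using arity_le (hI a ha))

theorem ncard_grounding_le [Nonempty C] (I : Finset (Fact ar C)) :
    (P.grounding I).ncard ≤ ∑ r ∈ P.rules, (activeDomain I).ncard ^ r.vars.ncard := by
  classical
  obtain ⟨c⟩ := ‹Nonempty C›
  have hdom := (activeDomain_finite I).to_subtype
  -- Only the variables of `r` matter; the others receive the default constant `c`.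
  let inst (r : Rule ar (Term C)) (f : r.vars → activeDomain I) : Rule ar C :=
    r.map (Term.inst fun x => if hx : x ∈ r.vars then (f ⟨x, hx⟩).1 else c)
  have hsub : P.grounding I ⊆ ⋃ r ∈ P.rules, Set.range (inst r) := by
    rintro _ ⟨r, hr, ν, hν, rfl⟩
    refine Set.mem_biUnion hr ⟨fun x => ⟨ν x.1, hν x.1 x.2⟩, r.map_inst_congr fun x hx => ?_⟩
    simp [hx]
  have hfin : ∀ r : Rule ar (Term C), (Set.range (inst r)).Finite := fun r => by
    have := r.vars_finite.to_subtype
    exact Set.finite_range _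
  refine (Set.ncard_le_ncard hsub (P.rules.finite_toSet.biUnion fun r _ => hfin r)).trans ?_
  refine (Finset.set_ncard_biUnion_le _ _).trans (Finset.sum_le_sum fun r _ => ?_)
  have := r.vars_finite.to_subtype
  have hcard : Nat.card (r.vars → activeDomain I) = (activeDomain I).ncard ^ r.vars.ncard := by
    rw [Nat.card_fun, Nat.card_coe_set_eq, Nat.card_coe_set_eq]
  rw [← hcard, ← Nat.card_coe_set_eq]
  exact Finite.card_range_le _

/-- The program is fixed, so the number of variables of a rule is a constant exponent. Input facts
have extensional predicates of bounded arity, so the active domain is linear in the input. -/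
theorem polyBounded_grounding [Nonempty C] : PolyBounded P fun I => (P.grounding I).ncard := by
  refine PolyBounded.mono (PolyBounded.sum P.rules fun r _ =>
    (PolyBounded.card.mul (PolyBounded.const P.arityBound)).pow r.vars.ncard) fun I hI => ?_
  exact (ncard_grounding_le I).trans
    (Finset.sum_le_sum fun r _ => Nat.pow_le_pow_left (ncard_activeDomain_le hI) _)

end Program

/-- The items are `[]`, `[a]`, the suffixes of grounded bodies and the singletons of their atoms; a
body of length `n` contributes at most `n + 1` suffixes and `n` singletons. -/
theorem exists_isClosed (P : Program ar C) (I : Finset (Fact ar C)) (a : Fact ar C) :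
    ∃ W, IsClosed P I W ∧ [a] ∈ W ∧
      W.card ≤ 2 + (P.grounding I).ncard * (2 * P.widthBound + 1) := by
  classical
  set G := (P.grounding_finite I).toFinset with hG
  have hmem : ∀ l, l ∈ ({[], [a]} ∪ G.biUnion fun g =>
        g.body.tails.toFinset ∪ (g.body.map fun b => [b]).toFinset : Finset (List (Fact ar C))) ↔
      l = [] ∨ l = [a] ∨ ∃ g ∈ P.grounding I, l <:+ g.body ∨ ∃ b ∈ g.body, l = [b] := by
    intro l
    simp [hG, eq_comm]
  refine ⟨_, ⟨?_, ?_, ?_, ?_⟩, (hmem _).2 (Or.inr (Or.inl rfl)), ?_⟩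
  · exact (hmem _).2 (Or.inl rfl)
  · exact fun g hg => (hmem _).2 (Or.inr (Or.inr ⟨g, hg, Or.inl List.suffix_rfl⟩))
  · intro b l h
    rcases (hmem _).1 h with h | h | ⟨g, hg, h | ⟨c, hc, h⟩⟩
    · exact absurd h (List.cons_ne_nil _ _)
    · exact (hmem _).2 (Or.inl (List.cons.inj h).2)
    · exact (hmem _).2 (Or.inr (Or.inr ⟨g, hg, Or.inl ((List.suffix_cons b l).trans h)⟩))
    · exact (hmem _).2 (Or.inl (List.cons.inj h).2)
  · intro b l h
    rcases (hmem _).1 h with h | h | ⟨g, hg, h | ⟨c, hc, h⟩⟩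
    · exact absurd h (List.cons_ne_nil _ _)
    · exact (hmem _).2 (Or.inr (Or.inl (by rw [(List.cons.inj h).1])))
    · exact (hmem _).2 (Or.inr (Or.inr ⟨g, hg, Or.inr ⟨b, h.subset (by simp), rfl⟩⟩))
    · exact (hmem _).2 (Or.inr (Or.inr ⟨g, hg, Or.inr ⟨c, hc, by rw [(List.cons.inj h).1]⟩⟩))
  · refine (Finset.card_union_le _ _).trans (Nat.add_le_add Finset.card_le_two ?_)
    rw [Set.ncard_eq_toFinset_card _ (P.grounding_finite I)]
    refine Finset.card_biUnion_le_card_mul _ _ _ fun g hg => ?_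
    have hlen := Program.length_body_le ((Set.Finite.mem_toFinset _).1 hg)
    refine (Finset.card_union_le _ _).trans ?_
    have h1 := List.toFinset_card_le g.body.tails
    have h2 := List.toFinset_card_le (g.body.map fun b => [b])
    simp only [List.length_tails, List.length_map] at h1 h2
    omega

/-! ### Linear programs -/

theorem FactTree.internalLabels_finite {I : Finset (Fact ar C)} (t : FactTree I) :
    t.internalLabels.Finite := by
  induction t with
  | leaf a => exact Set.finite_empty
  | node a n c ih => exact (Set.finite_iUnion ih).insert a

theorem FactTree.internalLabels_eq_empty_or {P : Program ar C} {I : Finset (Fact ar C)}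
    (t : FactTree I) (hd : t.Derives P) : t.internalLabels = ∅ ∨ P.IsIDB t.label.rel := by
  cases t with
  | leaf a => exact Or.inl rfl
  | node a n c =>
    obtain ⟨r, hr, ν, -, h⟩ := hd.1
    exact Or.inr ⟨r, hr, (congrArg (fun g : Rule ar C => g.head.rel) h).symm⟩

/-- Every vertex except the root is a child of an internal vertex, and the internal vertices form a
path with distinct labels. -/
theorem FactTree.size_le_of_isLinear {P : Program ar C} (hP : P.IsLinear) {I : Finset (Fact ar C)}
    (t : FactTree I) (hd : t.Derives P) (ht : t.IsTight) :
    t.size ≤ 1 + P.widthBound * t.internalLabels.ncard := by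
  induction t with
  | leaf a => simp [FactTree.size]
  | node a n c ih =>
    have hn : n ≤ P.widthBound := by simpa using Program.length_body_le hd.1
    -- A child that has internal vertices carries an intensional label, and linearity allows one
    -- such body atom.
    have huniq : ∀ i j, (c i).internalLabels ≠ ∅ → (c j).internalLabels ≠ ∅ → i = j := by
      intro i j hi hj
      obtain ⟨r, hr, ν, -, h⟩ := hd.1
      have hbody : (List.ofFn fun i => (c i).label) = r.body.map (Atom.map (Term.inst ν)) :=
        congrArg Rule.body h
      have hlen : n = r.body.length := by simpa using congrArg List.length hbody
      have hrel : ∀ i : Fin n, (r.body.get (i.cast hlen)).rel = (c i).label.rel := by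
        intro i
        have h1 : (List.ofFn fun i => (c i).label)[i.1]? =
          (r.body.map (Atom.map (Term.inst ν)))[i.1]? := by rw [hbody]
        have h2 : i.1 < r.body.length := hlen ▸ i.2
        simp only [List.getElem?_ofFn, i.2, List.getElem?_map, List.getElem?_eq_getElem h2,
          Option.map_some, dite_true, Option.some.injEq] at h1
        rw [h1]
        rfl
      have := hP r hr (i.cast hlen) (j.cast hlen)
        (by rw [hrel]; exact ((c i).internalLabels_eq_empty_or (hd.2 i)).resolve_left hi)
        (by rw [hrel]; exact ((c j).internalLabels_eq_empty_or (hd.2 j)).resolve_left hj)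
      exact Fin.ext (by simpa using congrArg Fin.val this)
    -- At most one summand is nonzero, and by tightness the root label is new to it.
    have hsum : ∑ i, (c i).internalLabels.ncard + 1 ≤ (node a n c).internalLabels.ncard := by
      have hfin := (node a n c).internalLabels_finite
      by_cases hex : ∃ i, (c i).internalLabels ≠ ∅
      · obtain ⟨i, hi⟩ := hex
        rw [Finset.sum_eq_single i (fun j _ hji => ?_) (by simp),
          ← Set.ncard_insert_of_notMem (ht.1 i) (c i).internalLabels_finite]
        · exact Set.ncard_le_ncard (Set.insert_subset_insert
            (Set.subset_iUnion (fun i => (c i).internalLabels) i)) hfin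
        · by_contra hj
          exact hji (huniq j i (fun h => hj (by rw [h, Set.ncard_empty])) hi)
      · rw [Finset.sum_eq_zero fun i _ => by
          rw [not_not.1 (not_exists.1 hex i), Set.ncard_empty], zero_add]
        exact (Set.ncard_pos hfin).2 ⟨a, Set.mem_insert _ _⟩
    have hsize : ∑ i, (c i).size ≤ n + P.widthBound * ∑ i, (c i).internalLabels.ncard := by
      refine (Finset.sum_le_sum fun i _ => ih i (hd.2 i) (ht.2 i)).trans ?_
      rw [Finset.sum_add_distrib, ← Finset.mul_sum]
      simp
    have := Nat.mul_le_mul_left P.widthBound hsum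
    simp only [FactTree.size]
    rw [mul_add] at this
    omega

theorem Program.IsLinear.polynomialFringe [Nonempty C] {P : Program ar C} (hP : P.IsLinear) :
    P.PolynomialFringe := by
  obtain ⟨d, hd⟩ := (PolyBounded.const 1).add
    ((PolyBounded.const P.widthBound).mul (Program.polyBounded_grounding (P := P)))
  refine ⟨(Polynomial.X + Polynomial.C 2) ^ d, fun I hI a _ t ht htight => ?_⟩
  simp only [Polynomial.eval_pow, Polynomial.eval_add, Polynomial.eval_X, Polynomial.eval_C]
  refine le_trans ?_ (hd I hI)
  refine (t.size_le_of_isLinear hP ht.2 htight).trans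
    (Nat.add_le_add_left (Nat.mul_le_mul_left _ ?_) 1)
  exact (Set.ncard_le_ncard (t.internalLabels_subset P ht.2)
    ((P.grounding_finite I).image _)).trans (Set.ncard_image_le (P.grounding_finite I))

end Datalog

namespace Datalog
variable {R C : Type*} {ar : R → ℕ}

/-! ### Circuits of polynomial size and squared logarithmic depth -/

/-- Rounding the input size up to a power of two costs less than a factor `2`, which keeps `2 ^ m`
polynomial. -/
theorem two_pow_clog_lt {n : ℕ} (hn : 2 ≤ n) : 2 ^ Nat.clog 2 n < 2 * n := by
  have h1 := Nat.pow_pred_clog_lt_self one_lt_two hn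
  have h2 := Nat.clog_pos one_lt_two hn
  obtain ⟨l, hl⟩ : ∃ l, Nat.clog 2 n = l + 1 := ⟨Nat.clog 2 n - 1, by omega⟩
  rw [hl, Nat.pred_succ] at h1
  rw [hl, pow_succ]
  omega

theorem PolyBounded.two_pow_clog {P : Program ar C} :
    PolyBounded P fun I => 2 ^ Nat.clog 2 (I.card + 2) :=
  ((PolyBounded.const 2).mul (PolyBounded.card.add (PolyBounded.const 2))).mono fun I _ =>
    (two_pow_clog_lt (by omega)).le

theorem clog_le_log (n : ℕ) :
    (Nat.clog 2 (n + 2) : ℝ) ≤ 2 / Real.log 2 * Real.log ((n : ℝ) + 2) := by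
  have hlog : 0 < Real.log 2 := Real.log_pos one_lt_two
  have h1 : (2 : ℝ) ^ Nat.clog 2 (n + 2) ≤ 2 * ((n : ℝ) + 2) := by
    exact_mod_cast (two_pow_clog_lt (n := n + 2) (by omega)).le
  have h2 := Real.log_le_log (by positivity) h1
  rw [Real.log_pow, Real.log_mul two_ne_zero (by positivity)] at h2
  have h3 : Real.log 2 ≤ Real.log ((n : ℝ) + 2) :=
    Real.log_le_log two_pos (by linarith [Nat.cast_nonneg (α := ℝ) n])
  rw [div_mul_eq_mul_div, le_div_iff₀ hlog]
  linarith

theorem Program.PolynomialFringe.exists_circuit [Nonempty C] {P : Program ar C}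
    (hP : P.PolynomialFringe) :
    ∃ (q : Polynomial ℕ) (c : ℝ), ∀ (S : Type*) [CommSemiring S], IsAbsorptive S →
      ∀ I : Finset (Fact ar C), P.IsInput I → ∀ α : Fact ar C, α.rel = P.target →
        ∃ F : Circuit {a // a ∈ I}, F.Computes S (P.provenance I α) ∧
          F.size ≤ q.eval I.card ∧ (F.depth : ℝ) ≤ c * Real.log ((I.card : ℝ) + 2) ^ 2 := by
  obtain ⟨q₀, hq₀⟩ := hP
  let w (I : Finset (Fact ar C)) : ℕ := 2 + (P.grounding I).ncard * (2 * P.widthBound + 1)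
  let l (I : Finset (Fact ar C)) : ℕ := Nat.clog 2 (I.card + 2)
  have hw : PolyBounded P w :=
    (PolyBounded.const 2).add (Program.polyBounded_grounding.mul (PolyBounded.const _))
  have hl : PolyBounded P l := PolyBounded.two_pow_clog.mono fun I _ => Nat.lt_two_pow_self.le
  obtain ⟨d₁, hd₁⟩ := (PolyBounded.const 4).mul (PolyBounded.eval (P := P) q₀)
  obtain ⟨d₂, hd₂⟩ := (PolyBounded.const 2).mul hw
  obtain ⟨d, hd⟩ := ((((PolyBounded.const 3).add (hw.pow 2)).add
    (((PolyBounded.const 4).mul (hl.mul (PolyBounded.const d₁))).mul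
      ((hw.pow 3).add ((hw.pow 2).mul (PolyBounded.two_pow_clog.pow d₂))))).add
    (PolyBounded.const 1))
  refine ⟨(Polynomial.X + Polynomial.C 2) ^ d,
    (4 * d₁ * (d₂ + 1) + 1) * (2 / Real.log 2) ^ 2, fun S _ hS I hI α hα => ?_⟩
  obtain ⟨W, hW, hαW, hcard⟩ := exists_isClosed P I α
  -- Exponents that are multiples of `l I` dominate any polynomial bound, so both `k` and `m` are
  -- constant multiples of a logarithm.
  have hpow : ∀ e, (I.card + 2) ^ e ≤ 2 ^ (l I * e) := fun e => by
    rw [pow_mul]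
    exact Nat.pow_le_pow_left (Nat.le_pow_clog one_lt_two _) e
  obtain ⟨F, h1, h2, h3⟩ := exists_circuit_provenance hS hW hαW
    (k := l I * d₁) (m := l I * d₂)
    ((Nat.mul_le_mul_left 2 hcard).trans ((hd₂ I hI).trans (hpow d₂)))
    (fun t ht htight => (Nat.mul_le_mul_left 4 (hq₀ I hI α hα t ht htight)).trans
      ((hd₁ I hI).trans (hpow d₁)))
  refine ⟨F, h1, h2.trans ?_, ?_⟩
  · simp only [Polynomial.eval_pow, Polynomial.eval_add, Polynomial.eval_X, Polynomial.eval_C]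
    refine le_trans ?_ (hd I hI)
    replace hcard : W.card ≤ w I := hcard
    rw [pow_mul]
    beta_reduce
    gcongr
  · have hl1 : 1 ≤ l I := Nat.clog_pos one_lt_two (by omega)
    -- Since `l I ≥ 1`, the additive ones are absorbed into the product of the number of rounds and
    -- the depth of a round.
    have h4 : F.depth ≤ (4 * d₁ * (d₂ + 1) + 1) * l I ^ 2 := by
      refine h3.trans ?_
      have h5 : l I * d₂ + 1 ≤ l I * (d₂ + 1) := by rw [mul_add]; omega
      calc 4 * (l I * d₁) * (l I * d₂ + 1) + 1
          ≤ 4 * (l I * d₁) * (l I * (d₂ + 1)) + l I ^ 2 :=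
            Nat.add_le_add (Nat.mul_le_mul_left _ h5) (Nat.one_le_pow _ _ hl1)
        _ = (4 * d₁ * (d₂ + 1) + 1) * l I ^ 2 := by ring
    calc (F.depth : ℝ) ≤ (4 * d₁ * (d₂ + 1) + 1) * (l I : ℝ) ^ 2 := by exact_mod_cast h4
      _ ≤ (4 * d₁ * (d₂ + 1) + 1) * (2 / Real.log 2 * Real.log ((I.card : ℝ) + 2)) ^ 2 := by
          gcongr
          exact clog_le_log I.card
      _ = _ := by ring

end Datalog

theorem mainTheorem4 {R C : Type*} [Nonempty C] {ar : R → ℕ} (P : Datalog.Program ar C) :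
    (P.PolynomialFringe →
      ∃ (q : Polynomial ℕ) (c : ℝ), ∀ (S : Type*) [CommSemiring S], Datalog.IsAbsorptive S →
        ∀ I : Finset (Datalog.Fact ar C), P.IsInput I →
          ∀ α : Datalog.Fact ar C, α.rel = P.target →
            ∃ F : Datalog.Circuit {a // a ∈ I}, F.Computes S (P.provenance I α) ∧
              F.size ≤ q.eval I.card ∧
              (F.depth : ℝ) ≤ c * Real.log ((I.card : ℝ) + 2) ^ 2) ∧
    (P.IsLinear →
      ∃ (q : Polynomial ℕ) (c : ℝ), ∀ (S : Type*) [CommSemiring S], Datalog.IsAbsorptive S →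
        ∀ I : Finset (Datalog.Fact ar C), P.IsInput I →
          ∀ α : Datalog.Fact ar C, α.rel = P.target →
            ∃ F : Datalog.Circuit {a // a ∈ I}, F.Computes S (P.provenance I α) ∧
              F.size ≤ q.eval I.card ∧
              (F.depth : ℝ) ≤ c * Real.log ((I.card : ℝ) + 2) ^ 2) :=
  ⟨fun h => h.exists_circuit, fun h => h.polynomialFringe.exists_circuit⟩
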